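/- Let $D$ be a finite digraph on $n$ vertices without loops or parallel arcs (pairs of opposite arcs $(u,v)$, $(v,u)$ are allowed). An out-branching of $D$ is a spanning subgraph $T$ of $D$ whose underlying undirected graph is a tree and in which exactly one vertex, the root, has in-degree $0$ while every other vertex has in-degree $1$; its leaves are the vertices of out-degree $0$ in $T$. Let $\ell_s(D)$ be the maximum number of leaves over all out-branchings of $D$ (and $0$ if $D$ has no out-branching). An arc of $D$ is useless if no out-branching of $D$ contains it. $D$ is an oriented graph if $(u,v)\in A(D)$ implies $(v,u)\notin A(D)$. Suppose that every vertex of $D$ has in-degree at least $3$, or that $D$ is an oriented graph in which every vertex has in-degree at least $2$. - If $D$ is strongly connected, then $\ell_s(D)\ge \frac14\sqrt n$. - If $D$ contains no useless arcs, then $\ell_s(D)\ge \frac1{12}\sqrt n$. -/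

import Mathlib

namespace Digraph

variable {V : Type*}

/-- The in-degree of `v`: the number of arcs `(u, v)` of `D`. -/
noncomputable def inDegree (D : Digraph V) (v : V) : ℕ :=
  {u : V | D.Adj u v}.ncard

/-- An oriented graph: if `(u, v)` is an arc then `(v, u)` is not. -/
def IsOriented (D : Digraph V) : Prop :=
  ∀ u v : V, D.Adj u v → ¬ D.Adj v u

/-- Every vertex can be reached from every vertex along arcs of `D`. -/
def IsStronglyConnected (D : Digraph V) : Prop :=
  ∀ u v : V, Relation.ReflTransGen D.Adj u v

/-- `T` is an out-branching of `D`: a spanning subgraph of `D` whose underlying undirected graph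
is a tree, in which one vertex (the root) has in-degree `0` and every other vertex has
in-degree `1`. -/
structure IsOutBranching (D T : Digraph V) : Prop where
  le : T ≤ D
  isTree : T.toSimpleGraphInclusive.IsTree
  exists_root : ∃ r : V, T.inDegree r = 0 ∧ ∀ v : V, v ≠ r → T.inDegree v = 1

/-- The leaves of `T`: the vertices of out-degree `0`. -/
def leaves (T : Digraph V) : Set V :=
  {v : V | ∀ w : V, ¬ T.Adj v w}

/-- The maximum number of leaves over all out-branchings of `D` (for a finite vertex set and a
digraph `D` that has an out-branching; see `isGreatest_maxLeaves`). It is `0` if `D` has no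
out-branching. -/
noncomputable def maxLeaves (D : Digraph V) : ℕ :=
  sSup {k : ℕ | ∃ T : Digraph V, D.IsOutBranching T ∧ T.leaves.ncard = k}

theorem isGreatest_maxLeaves [Finite V] (D : Digraph V) (h : ∃ T, D.IsOutBranching T) :
    IsGreatest {k : ℕ | ∃ T : Digraph V, D.IsOutBranching T ∧ T.leaves.ncard = k}
      D.maxLeaves := by
  obtain ⟨T, hT⟩ := h
  have hb : BddAbove {k : ℕ | ∃ T : Digraph V, D.IsOutBranching T ∧ T.leaves.ncard = k} := by
    refine ⟨Nat.card V, ?_⟩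
    rintro k ⟨S, -, rfl⟩
    exact Set.ncard_le_card S.leaves
  exact ⟨Nat.sSup_mem ⟨_, T, hT, rfl⟩ hb, fun k hk => le_csSup hb hk⟩

/-- The arc `(u, v)` of `D` is useless: no out-branching of `D` contains it. -/
def IsUseless (D : Digraph V) (u v : V) : Prop :=
  D.Adj u v ∧ ¬ ∃ T : Digraph V, D.IsOutBranching T ∧ T.Adj u v

end Digraph

/-! ### Out-trees: extending them, joining them, turning them into out-branchings. -/

namespace Digraph

variable {V : Type*}

/-! Let K bound the number of leaves of every out-tree of D, spanning or not. The core is n ≤ 16K²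
(`IsOutTree.card_le`). Take a spanning out-tree with the most leaves for its root. Fewer than 2K of
its vertices have a number of children other than one, so it suffices that chains of one-child
vertices have length O(K). By maximality no arc jumps forward along such a chain: rerouting along it
would create a leaf (`not_adj_of_max`). By the degree hypothesis each inner chain vertex has an
in-neighbour other than its two chain neighbours; it lies in the subtree below the chain, in the
rest of the tree, or at least two steps later on the chain. So every inner vertex is reached from
one of two out-trees off the chain by backward jumps alone, and `attach_path` yields an out-tree
with about a third as many leaves as there are vertices reached (`path_length_le`).

If D is strongly connected, every out-tree extends to an out-branching without losing leaves, so K =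
ℓ_s works. Without useless arcs K = 3ℓ_s works (`card_treeLeaves_le`). Let L be the leaves of an
out-tree whose root s does not reach everything, and I ⊆ L those that lie on every walk to s from a
vertex r that reaches everything. The set I is a chain under domination, and some out-branching has
a leaf in the layer before each member, so |I| ≤ ℓ_s. A level count in the spirit of Menger gives an
out-tree from r through s that meets L in at most (|L| + |I|)/2 vertices; joined to the given tree
it keeps the other leaves. Hence |L| ≤ ℓ_s + (|L| + ℓ_s)/2. -/

/-- The vertices in `S` form an out-tree of the relation `R` with root `r`, in which `p v` is the
parent of `v ≠ r`; the rank `h`, which increases along arcs, excludes cycles. -/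
structure IsOutTree (R : V → V → Prop) (S : Finset V) (r : V) (p : V → V) (h : V → ℕ) : Prop where
  root_mem : r ∈ S
  parent_mem : ∀ v ∈ S, v ≠ r → p v ∈ S
  adj : ∀ v ∈ S, v ≠ r → R (p v) v
  rank_lt : ∀ v ∈ S, v ≠ r → h (p v) < h v

/-- The leaves of the out-tree with vertex set `S`, root `r` and parent function `p`. -/
def treeLeaves [DecidableEq V] (S : Finset V) (r : V) (p : V → V) : Finset V :=
  S \ (S.erase r).image p

namespace IsOutTree

variable {R : V → V → Prop} {S : Finset V} {r : V} {p : V → V} {h : V → ℕ}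

theorem singleton (R : V → V → Prop) (r : V) : IsOutTree R {r} r id (fun _ => 0) where
  root_mem := by simp
  parent_mem := by simp
  adj := by simp
  rank_lt := by simp

theorem mono {R' : V → V → Prop} (hT : IsOutTree R S r p h) (hR : ∀ u v, R u v → R' u v) :
    IsOutTree R' S r p h :=
  ⟨hT.root_mem, hT.parent_mem, fun v hv hr => hR _ _ (hT.adj v hv hr), hT.rank_lt⟩

theorem reflTransGen (hT : IsOutTree R S r p h) {v : V} (hv : v ∈ S) :
    Relation.ReflTransGen R r v := by
  induction hn : h v using Nat.strong_induction_on generalizing v with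
  | _ n ih =>
    by_cases hr : v = r
    · subst hr; exact .refl
    · exact (ih _ (hn ▸ hT.rank_lt v hv hr) (hT.parent_mem v hv hr) rfl).tail (hT.adj v hv hr)

variable [DecidableEq V]

theorem _root_.Digraph.mem_treeLeaves {x : V} :
    x ∈ treeLeaves S r p ↔ x ∈ S ∧ ∀ w ∈ S, w ≠ r → p w ≠ x := by
  simp only [treeLeaves, Finset.mem_sdiff, Finset.mem_image, Finset.mem_erase, not_exists, not_and]
  exact and_congr_right fun _ => ⟨fun H w hw hr => H w ⟨hr, hw⟩, fun H w hw => H w hw.2 hw.1⟩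

theorem image_subset (hT : IsOutTree R S r p h) : (S.erase r).image p ⊆ S := by
  intro x hx
  obtain ⟨v, hv, rfl⟩ := Finset.mem_image.1 hx
  exact hT.parent_mem v (Finset.mem_of_mem_erase hv) (Finset.ne_of_mem_erase hv)

theorem card_treeLeaves_add (hT : IsOutTree R S r p h) :
    (treeLeaves S r p).card + ((S.erase r).image p).card = S.card :=
  Finset.card_sdiff_add_card_eq_card hT.image_subset

theorem treeLeaves_nonempty (hT : IsOutTree R S r p h) : (treeLeaves S r p).Nonempty := by
  obtain ⟨x, hx, hmax⟩ := S.exists_max_image h ⟨r, hT.root_mem⟩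
  refine ⟨x, mem_treeLeaves.2 ⟨hx, fun w hw hr he => ?_⟩⟩
  have := hT.rank_lt w hw hr
  rw [he] at this
  exact absurd (hmax w hw) (not_le.2 this)

/-- A new vertex can be attached to an out-tree. -/
theorem insert_vertex (hT : IsOutTree R S r p h) {u v : V} (hu : u ∈ S) (hv : v ∉ S) (huv : R u v) :
    IsOutTree R (insert v S) r (Function.update p v u) (Function.update h v (h u + 1)) := by
  have hne : ∀ x ∈ S, x ≠ v := fun x hx he => hv (he ▸ hx)
  refine ⟨Finset.mem_insert_of_mem hT.root_mem, ?_, ?_, ?_⟩ <;> intro x hx hr <;>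
    rcases Finset.mem_insert.1 hx with rfl | hx
  · simp [hu]
  · rw [Function.update_of_ne (hne x hx)]
    exact Finset.mem_insert_of_mem (hT.parent_mem x hx hr)
  · simpa using huv
  · rw [Function.update_of_ne (hne x hx)]
    exact hT.adj x hx hr
  · simp [Function.update_of_ne (hne u hu)]
  · rw [Function.update_of_ne (hne x hx), Function.update_of_ne (hne x hx),
      Function.update_of_ne (hne _ (hT.parent_mem x hx hr))]
    exact hT.rank_lt x hx hr

/-- One vertex is added and at most one, namely `u`, becomes internal. -/
theorem card_treeLeaves_insert (hT : IsOutTree R S r p h) {u v : V} (hu : u ∈ S) (hv : v ∉ S)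
    (huv : R u v) :
    (treeLeaves S r p).card ≤ (treeLeaves (insert v S) r (Function.update p v u)).card := by
  have h1 := hT.card_treeLeaves_add
  have h2 := (hT.insert_vertex hu hv huv).card_treeLeaves_add
  rw [Finset.card_insert_of_notMem hv] at h2
  have h3 : (((insert v S).erase r).image (Function.update p v u)) ⊆
      insert u ((S.erase r).image p) := by
    intro x hx
    obtain ⟨w, hw, rfl⟩ := Finset.mem_image.1 hx
    by_cases hwv : w = v
    · subst hwv; simp
    · rw [Function.update_of_ne hwv]
      have hw' := Finset.mem_of_mem_insert_of_ne (Finset.mem_of_mem_erase hw) hwv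
      exact Finset.mem_insert_of_mem (Finset.mem_image_of_mem _
        (Finset.mem_erase.2 ⟨Finset.ne_of_mem_erase hw, hw'⟩))
  have h4 := (Finset.card_le_card h3).trans (Finset.card_insert_le _ _)
  omega

/-- Every out-tree extends to one that no arc leaves, without losing leaves. -/
theorem exists_closed [Fintype V] (hT : IsOutTree R S r p h) :
    ∃ S' p' h', IsOutTree R S' r p' h' ∧ S ⊆ S' ∧ (∀ v ∈ S, p' v = p v) ∧
      (∀ u ∈ S', ∀ v, R u v → v ∈ S') ∧
      (treeLeaves S r p).card ≤ (treeLeaves S' r p').card := by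
  induction hn : Sᶜ.card using Nat.strong_induction_on generalizing S p h with
  | _ n ih =>
    by_cases hc : ∀ u ∈ S, ∀ v, R u v → v ∈ S
    · exact ⟨S, p, h, hT, subset_rfl, fun _ _ => rfl, hc, le_rfl⟩
    push Not at hc
    obtain ⟨u, hu, v, huv, hv⟩ := hc
    have hlt : (insert v S)ᶜ.card < n := by
      rw [← hn]
      apply Finset.card_lt_card
      rw [Finset.compl_ssubset_compl]
      exact Finset.ssubset_insert hv
    obtain ⟨S', p', h', h1, h2, h3, h4, h5⟩ := ih _ hlt (hT.insert_vertex hu hv huv) rfl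
    refine ⟨S', p', h', h1, (Finset.subset_insert _ _).trans h2, fun w hw => ?_, h4,
      (hT.card_treeLeaves_insert hu hv huv).trans h5⟩
    rw [h3 w (Finset.mem_insert_of_mem hw), Function.update_of_ne]
    rintro rfl
    exact hv hw

/-- A set closed under out-arcs contains everything its root reaches. Keeping the old parents
matters later, where the extension must not hang vertices of `S` elsewhere. -/
theorem exists_spanning [Fintype V] (hT : IsOutTree R S r p h)
    (hr : ∀ v, Relation.ReflTransGen R r v) :
    ∃ p' h', IsOutTree R Finset.univ r p' h' ∧ (∀ v ∈ S, p' v = p v) ∧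
      (treeLeaves S r p).card ≤ (treeLeaves Finset.univ r p').card := by
  obtain ⟨S', p', h', h1, h2, h3, h4, h5⟩ := hT.exists_closed
  have : S' = Finset.univ := by
    refine Finset.eq_univ_iff_forall.2 fun v => ?_
    induction hr v with
    | refl => exact h1.root_mem
    | tail _ huv ih => exact h4 _ ih _ huv
  subst this
  exact ⟨p', h', h1, h3, h5⟩

/-- An out-tree rooted at `r` through `s`, joined with an out-tree rooted at `s`. -/
theorem join {Y : Finset V} {s : V} {pY pS : V → V} {hY hS : V → ℕ}
    (hTY : IsOutTree R Y r pY hY) (hTS : IsOutTree R S s pS hS) (hs : s ∈ Y) :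
    ∃ p' h', IsOutTree R (Y ∪ S) r p' h' ∧
      treeLeaves S s pS \ Y ⊆ treeLeaves (Y ∪ S) r p' := by
  refine ⟨fun v => if v ∈ Y then pY v else pS v,
    -- Vertices outside `Y` may have parents inside `Y`, so their ranks are shifted above all ranks
    -- on `Y`.
    fun v => if v ∈ Y then hY v else Y.sup hY + 1 + hS v,
    ⟨Finset.mem_union_left _ hTY.root_mem, ?_, ?_, ?_⟩, ?_⟩
  · intro v hv hr
    by_cases hvY : v ∈ Y
    · simp [hvY, hTY.parent_mem v hvY hr]
    · have hvS := (Finset.mem_union.1 hv).resolve_left hvY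
      have : v ≠ s := fun he => hvY (he ▸ hs)
      simp [hvY, hTS.parent_mem v hvS this]
  · intro v hv hr
    by_cases hvY : v ∈ Y
    · simp [hvY, hTY.adj v hvY hr]
    · have hvS := (Finset.mem_union.1 hv).resolve_left hvY
      have : v ≠ s := fun he => hvY (he ▸ hs)
      simp [hvY, hTS.adj v hvS this]
  · intro v hv hr
    by_cases hvY : v ∈ Y
    · simp [hvY, hTY.rank_lt v hvY hr, hTY.parent_mem v hvY hr]
    · have hvS := (Finset.mem_union.1 hv).resolve_left hvY
      have : v ≠ s := fun he => hvY (he ▸ hs)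
      simp only [hvY, if_false]
      split_ifs with hp
      · have := Finset.le_sup (f := hY) hp
        omega
      · have := hTS.rank_lt v hvS this
        omega
  · intro x hx
    obtain ⟨hx, hxY⟩ := Finset.mem_sdiff.1 hx
    obtain ⟨hxS, hx⟩ := mem_treeLeaves.1 hx
    refine mem_treeLeaves.2 ⟨Finset.mem_union_right _ hxS, fun w hw hr he => ?_⟩
    by_cases hwY : w ∈ Y
    · simp only [hwY, if_true] at he
      exact hxY (he ▸ hTY.parent_mem w hwY hr)
    · simp only [hwY, if_false] at he
      have hws : w ≠ s := fun he => hwY (he ▸ hs)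
      exact hx w ((Finset.mem_union.1 hw).resolve_left hwY) hws he

/-- The spanning subgraph of arcs from parents to children is an out-branching. -/
theorem isOutBranching [Fintype V] {D : Digraph V}
    (hT : IsOutTree D.Adj Finset.univ r p h) :
    D.IsOutBranching { Adj := fun u v => v ≠ r ∧ u = p v } := by
  set T : Digraph V := { Adj := fun u v => v ≠ r ∧ u = p v } with hTdef
  have hne : ∀ v, v ≠ r → p v ≠ v := fun v hv he => by
    have := hT.rank_lt v (Finset.mem_univ _) hv
    rw [he] at this
    exact lt_irrefl _ this
  have hadj : ∀ v, v ≠ r → T.toSimpleGraphInclusive.Adj (p v) v := fun v hv =>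
    (SimpleGraph.fromRel_adj _ _ _).2 ⟨hne v hv, Or.inl ⟨hv, rfl⟩⟩
  refine ⟨?_, ?_, r, ?_, ?_⟩
  · rintro u v ⟨hv, rfl⟩
    exact hT.adj v (Finset.mem_univ _) hv
  · have hreach : ∀ v, T.toSimpleGraphInclusive.Reachable r v := by
      intro v
      induction hn : h v using Nat.strong_induction_on generalizing v with
      | _ n ih =>
        by_cases hv : v = r
        · subst hv; rfl
        · exact (ih _ (hn ▸ hT.rank_lt v (Finset.mem_univ _) hv) _ rfl).trans
            (hadj v hv).reachable
    have hconn : T.toSimpleGraphInclusive.Connected := by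
      have : Nonempty V := ⟨r⟩
      exact ⟨fun u v => (hreach u).symm.trans (hreach v)⟩
    rw [SimpleGraph.isTree_iff_connected_and_card]
    refine ⟨hconn, le_antisymm ?_ hconn.card_vert_le_card_edgeSet_add_one⟩
    have hsub : T.toSimpleGraphInclusive.edgeSet ⊆
        (((Finset.univ.erase r).image fun v => s(p v, v) : Finset (Sym2 V)) : Set (Sym2 V)) := by
      intro e
      induction e using Sym2.ind with
      | _ u v =>
        intro he
        rw [SimpleGraph.mem_edgeSet] at he
        obtain ⟨-, ⟨hv, rfl⟩ | ⟨hu, rfl⟩⟩ := (SimpleGraph.fromRel_adj _ _ _).1 he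
        · simpa using ⟨v, hv, Or.inl ⟨rfl, rfl⟩⟩
        · simpa using ⟨u, hu, Or.inr ⟨rfl, rfl⟩⟩
    have h1 := Set.ncard_le_ncard hsub (Finset.finite_toSet _)
    rw [Set.ncard_coe_finset] at h1
    have h2 := h1.trans Finset.card_image_le
    rw [Finset.card_erase_of_mem (Finset.mem_univ _), Finset.card_univ] at h2
    have : 0 < Fintype.card V := Fintype.card_pos_iff.2 ⟨r⟩
    rw [Nat.card_eq_fintype_card (α := V), Nat.card_coe_set_eq]
    omega
  · simp [inDegree, hTdef]
  · intro v hv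
    simp [inDegree, hTdef, hv]

theorem card_treeLeaves_le_maxLeaves [Fintype V] {D : Digraph V}
    (hT : IsOutTree D.Adj Finset.univ r p h) :
    (treeLeaves Finset.univ r p).card ≤ D.maxLeaves := by
  refine (D.isGreatest_maxLeaves ⟨_, hT.isOutBranching⟩).2 ⟨_, hT.isOutBranching, ?_⟩
  rw [← Set.ncard_coe_finset]
  congr 1
  ext x
  simp only [leaves, Set.mem_ofPred_eq, Finset.mem_coe, mem_treeLeaves, Finset.mem_univ, true_and,
    not_and, true_implies]
  exact forall_congr' fun w => forall_congr' fun _ => ne_comm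

end IsOutTree

end Digraph

/-! ### Growing an out-tree along backward jumps on a path. -/

namespace Digraph

variable {V : Type*}

/-- A greedy choice, from the largest element of `E` down: `j` is rejected if its successor has been
chosen and is the value `f i` of a chosen `i` at which `f` is relevant. -/
theorem exists_greedy_subset (E : Finset ℕ) (f : ℕ → ℕ) (G : ℕ → Prop)
    (hf : ∀ i ∈ E, G i → f i < i) :
    ∃ X ⊆ E, ∀ j ∈ E, (j ∈ X ↔ ¬ (j + 1 ∈ X ∧ ∃ i ∈ X, G i ∧ f i = j + 1)) := by
  classical
  induction E using Finset.induction_on_min with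
  | empty => exact ⟨∅, by simp⟩
  | insert a E ha ih =>
    obtain ⟨X, hXE, hX⟩ := ih fun i hi => hf i (Finset.mem_insert_of_mem hi)
    have haE : a ∉ E := fun h => lt_irrefl _ (ha a h)
    have haX : a ∉ X := fun h => haE (hXE h)
    by_cases hc : a + 1 ∈ X ∧ ∃ i ∈ X, G i ∧ f i = a + 1
    · refine ⟨X, hXE.trans (Finset.subset_insert _ _), fun j hj => ?_⟩
      rcases Finset.mem_insert.1 hj with rfl | hj
      · exact ⟨fun h => absurd h haX, fun h => absurd hc h⟩
      · exact hX j hj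
    · refine ⟨insert a X, Finset.insert_subset_insert _ hXE, fun j hj => ?_⟩
      -- Deciding on `a` does not disturb earlier decisions: for `j ≥ a`, neither `a` nor `f a < a`
      -- equals `j + 1`.
      have key : ∀ j, a ≤ j → ((j + 1 ∈ insert a X ∧ ∃ i ∈ insert a X, G i ∧ f i = j + 1) ↔
          (j + 1 ∈ X ∧ ∃ i ∈ X, G i ∧ f i = j + 1)) := by
        intro j hj
        have h1 : j + 1 ∈ insert a X ↔ j + 1 ∈ X := by
          rw [Finset.mem_insert]
          exact or_iff_right (by omega)
        rw [h1]
        refine and_congr_right fun _ => ⟨?_, fun ⟨i, hi, h⟩ => ⟨i, Finset.mem_insert_of_mem hi, h⟩⟩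
        rintro ⟨i, hi, hG, he⟩
        rcases Finset.mem_insert.1 hi with rfl | hi
        · have := hf i (Finset.mem_insert_self _ _) hG
          omega
        · exact ⟨i, hi, hG, he⟩
      rcases Finset.mem_insert.1 hj with rfl | hj
      · rw [key j le_rfl]
        exact ⟨fun _ => hc, fun _ => Finset.mem_insert_self _ _⟩
      · have hlt := ha j hj
        rw [key j hlt.le, ← hX j hj, Finset.mem_insert]
        exact or_iff_right (by omega)

/-- Attaching vertices of a path `x s → ⋯ → x 1` to an out-tree. -/
theorem IsOutTree.attach_path [DecidableEq V] {R : V → V → Prop} {S : Finset V} {r : V} {p : V → V}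
    {h : V → ℕ} (hT : IsOutTree R S r p h) (x : ℕ → V) (s : ℕ)
    (hinj : Set.InjOn x (Set.Icc 1 s)) (hxS : ∀ i, 1 ≤ i → i ≤ s → x i ∉ S)
    (hadj : ∀ i, 1 ≤ i → i < s → R (x (i + 1)) (x i))
    (E : Finset ℕ) (hE : ∀ i ∈ E, 1 ≤ i ∧ i ≤ s)
    (hpar : ∀ i ∈ E, (∃ u ∈ S, R u (x i)) ∨ ∃ j ∈ E, j + 2 ≤ i ∧ R (x j) (x i)) :
    ∃ S' p' h', IsOutTree R S' r p' h' ∧ E.card ≤ 3 * (treeLeaves S' r p').card + 1 := by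
  classical
  set G : ℕ → Prop := fun i => ¬ ∃ u ∈ S, R u (x i) with hGdef
  have hf : ∀ i, ∃ j, i ∈ E → G i → j ∈ E ∧ j + 2 ≤ i ∧ R (x j) (x i) := by
    intro i
    by_cases hi : i ∈ E ∧ G i
    · obtain ⟨j, hj⟩ := (hpar i hi.1).resolve_left hi.2
      exact ⟨j, fun _ _ => hj⟩
    · exact ⟨0, fun h1 h2 => absurd ⟨h1, h2⟩ hi⟩
  choose f hf using hf
  have hu : ∀ i, ∃ u, ¬ G i → u ∈ S ∧ R u (x i) := by
    intro i
    by_cases hi : G i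
    · exact ⟨x i, fun h => absurd hi h⟩
    · obtain ⟨u, hu⟩ := not_not.1 hi
      exact ⟨u, fun _ => hu⟩
  choose u hu using hu
  obtain ⟨X, hXE, hX⟩ := exists_greedy_subset E f G fun i hi hG => by
    have := (hf i hi hG).2.1
    omega
  -- Path vertices indexed by `TG` are internal in the new tree. The path arc out of such a vertex
  -- then attaches a further vertex at no cost in leaves; `N` collects the indices attached this
  -- way, and the greedy rule puts every rejected index into `N`.
  set TG := (X.filter G).image f with hTG
  set N := (Finset.Icc 1 s).filter fun j => j + 1 ∈ X ∧ j + 1 ∈ TG with hN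
  have hmemTG : ∀ j, j ∈ TG ↔ ∃ i ∈ X, G i ∧ f i = j := by
    intro j
    simp [hTG, and_assoc]
  have hmemN : ∀ j, j ∈ N ↔ 1 ≤ j ∧ j + 1 ∈ X ∧ j + 1 ∈ TG := by
    intro j
    simp only [hN, Finset.mem_filter, Finset.mem_Icc]
    refine ⟨fun h => ⟨h.1.1, h.2⟩, fun h => ⟨⟨h.1, ?_⟩, h.2⟩⟩
    have := (hE _ (hXE h.2.1)).2
    omega
  have hXN : Disjoint X N := by
    rw [Finset.disjoint_left]
    intro j hjX hjN
    obtain ⟨-, h2, h3⟩ := (hmemN j).1 hjN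
    exact (hX j (hXE hjX)).1 hjX ⟨h2, (hmemTG _).1 h3⟩
  have hEXN : E ⊆ X ∪ N := by
    intro j hj
    by_cases hjX : j ∈ X
    · exact Finset.mem_union_left _ hjX
    · have h1 := not_not.1 (mt (hX j hj).2 hjX)
      exact Finset.mem_union_right _ ((hmemN j).2 ⟨(hE j hj).1, h1.1, (hmemTG _).2 h1.2⟩)
  have hXN1 : ∀ j ∈ X ∪ N, 1 ≤ j ∧ j ≤ s := by
    intro j hj
    rcases Finset.mem_union.1 hj with hj | hj
    · exact hE j (hXE hj)
    · have h1 := (hmemN j).1 hj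
      have := (hE _ (hXE h1.2.1)).2
      omega
  have hTGE : TG ⊆ E := by
    intro j hj
    obtain ⟨i, hi, hG, rfl⟩ := (hmemTG j).1 hj
    exact (hf i (hXE hi) hG).1
  obtain ⟨idx, hidx⟩ : ∃ idx : V → ℕ, ∀ i, 1 ≤ i → i ≤ s → idx (x i) = i :=
    ⟨Function.invFunOn x (Set.Icc 1 s), fun i h1 h2 => hinj.leftInvOn_invFunOn ⟨h1, h2⟩⟩
  set M := S.sup h + 1 with hM
  set p' : V → V := fun v => if v ∈ S then p v else if idx v ∈ X then
    (if G (idx v) then x (f (idx v)) else u (idx v)) else x (idx v + 1) with hp'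
  -- Above `M`, an index `i ∈ N` hangs from `i + 1 ∈ X` of rank 2i + 2, and a jump into `i ∈ X`
  -- comes from an index at most i - 2, of rank at most 2(i - 2) + 3 < 2i. This needs jumps of
  -- length at least two.
  set h' : V → ℕ := fun v => if v ∈ S then h v else
    M + (if idx v ∈ X then 2 * idx v else 2 * idx v + 3) with hh'
  have hpS : ∀ v ∈ S, p' v = p v := fun v hv => by simp [hp', hv]
  have hhS : ∀ v ∈ S, h' v = h v := fun v hv => by simp [hh', hv]
  have hhSM : ∀ v ∈ S, h' v < M := fun v hv => by
    rw [hhS v hv]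
    have := Finset.le_sup (f := h) hv
    omega
  have hpG : ∀ i ∈ X, G i → p' (x i) = x (f i) := fun i hi hG => by
    have h1 := hE i (hXE hi)
    simp only [hp', hxS i h1.1 h1.2, if_false, hidx i h1.1 h1.2, hi, if_true, hG]
  have hpnG : ∀ i ∈ X, ¬ G i → p' (x i) = u i := fun i hi hG => by
    have h1 := hE i (hXE hi)
    simp only [hp', hxS i h1.1 h1.2, if_false, hidx i h1.1 h1.2, hi, if_true, hG]
  have hpN : ∀ i ∈ N, p' (x i) = x (i + 1) := fun i hi => by
    have h1 := hXN1 i (Finset.mem_union_right _ hi)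
    have h2 : i ∉ X := fun h => Finset.disjoint_left.1 hXN h hi
    simp only [hp', hxS i h1.1 h1.2, if_false, hidx i h1.1 h1.2, h2]
  have hhX : ∀ i ∈ X, h' (x i) = M + 2 * i := fun i hi => by
    have h1 := hE i (hXE hi)
    simp only [hh', hxS i h1.1 h1.2, if_false, hidx i h1.1 h1.2, hi, if_true]
  have hhN : ∀ i ∈ N, h' (x i) = M + (2 * i + 3) := fun i hi => by
    have h1 := hXN1 i (Finset.mem_union_right _ hi)
    have h2 : i ∉ X := fun h => Finset.disjoint_left.1 hXN h hi
    simp only [hh', hxS i h1.1 h1.2, if_false, hidx i h1.1 h1.2, h2]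
  have hS' : ∀ v, v ∈ S ∪ (X ∪ N).image x ↔ v ∈ S ∨ (∃ i ∈ X, x i = v) ∨ ∃ i ∈ N, x i = v := by
    intro v
    simp only [Finset.mem_union, Finset.mem_image, or_and_right, exists_or]
  have hxS' : ∀ i ∈ X ∪ N, x i ∈ S ∪ (X ∪ N).image x := fun i hi =>
    Finset.mem_union_right _ (Finset.mem_image_of_mem _ hi)
  have htree : IsOutTree R (S ∪ (X ∪ N).image x) r p' h' := by
    refine ⟨Finset.mem_union_left _ hT.root_mem, ?_, ?_, ?_⟩ <;> intro v hv hr <;>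
      obtain hv | ⟨i, hi, rfl⟩ | ⟨i, hi, rfl⟩ := (hS' v).1 hv
    · rw [hpS v hv]
      exact Finset.mem_union_left _ (hT.parent_mem v hv hr)
    · by_cases hG : G i
      · rw [hpG i hi hG]
        exact hxS' _ (hEXN (hf i (hXE hi) hG).1)
      · rw [hpnG i hi hG]
        exact Finset.mem_union_left _ (hu i hG).1
    · rw [hpN i hi]
      exact hxS' _ (Finset.mem_union_left _ ((hmemN i).1 hi).2.1)
    · rw [hpS v hv]
      exact hT.adj v hv hr
    · by_cases hG : G i
      · rw [hpG i hi hG]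
        exact (hf i (hXE hi) hG).2.2
      · rw [hpnG i hi hG]
        exact (hu i hG).2
    · rw [hpN i hi]
      have h1 := (hmemN i).1 hi
      exact hadj i h1.1 (hE _ (hXE h1.2.1)).2
    · rw [hpS v hv, hhS v hv, hhS _ (hT.parent_mem v hv hr)]
      exact hT.rank_lt v hv hr
    · rw [hhX i hi]
      by_cases hG : G i
      · rw [hpG i hi hG]
        have h1 := hf i (hXE hi) hG
        rcases Finset.mem_union.1 (hEXN h1.1) with h2 | h2
        · rw [hhX _ h2]; omega
        · rw [hhN _ h2]; omega
      · rw [hpnG i hi hG]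
        have := hhSM _ (hu i hG).1
        omega
    · rw [hpN i hi, hhN i hi, hhX _ ((hmemN i).1 hi).2.1]
      omega
  refine ⟨_, p', h', htree, ?_⟩
  have hxinj : ∀ i ∈ X ∪ N, ∀ j ∈ X ∪ N, x i = x j → i = j := fun i hi j hj he =>
    hinj ⟨(hXN1 i hi).1, (hXN1 i hi).2⟩ ⟨(hXN1 j hj).1, (hXN1 j hj).2⟩ he
  have hleaf : ((X ∪ N) \ TG).image x ⊆ treeLeaves (S ∪ (X ∪ N).image x) r p' := by
    intro v hv
    obtain ⟨j, hj, rfl⟩ := Finset.mem_image.1 hv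
    obtain ⟨hj, hjT⟩ := Finset.mem_sdiff.1 hj
    refine mem_treeLeaves.2 ⟨hxS' j hj, fun w hw hr he => ?_⟩
    have hjS := hxS j (hXN1 j hj).1 (hXN1 j hj).2
    obtain hw | ⟨i, hi, rfl⟩ | ⟨i, hi, rfl⟩ := (hS' w).1 hw
    · rw [hpS w hw] at he
      exact hjS (he ▸ hT.parent_mem w hw hr)
    · by_cases hG : G i
      · rw [hpG i hi hG] at he
        have := hxinj _ (hEXN (hf i (hXE hi) hG).1) j hj he
        exact hjT ((hmemTG j).2 ⟨i, hi, hG, this⟩)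
      · rw [hpnG i hi hG] at he
        exact hjS (he ▸ (hu i hG).1)
    · rw [hpN i hi] at he
      have h1 := (hmemN i).1 hi
      have := hxinj _ (Finset.mem_union_left _ h1.2.1) j hj he
      exact hjT (this ▸ h1.2.2)
  have hL := Finset.card_le_card hleaf
  rw [Finset.card_image_of_injOn fun i hi j hj => hxinj i (Finset.mem_sdiff.1 hi).1 j
    (Finset.mem_sdiff.1 hj).1] at hL
  -- With ℓ leaves, |X| + |N| - |TG| ≤ ℓ and |TG| ≤ |X| give |N| ≤ ℓ. Every element of X ∩ TG except
  -- possibly 1 is the successor of an element of N, so |X| ≤ ℓ + |N| + 1. Hence |E| ≤ |X| + |N| ≤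
  -- 3ℓ + 1.
  have c1 : ((X ∪ N) \ TG).card + TG.card = (X ∪ N).card :=
    Finset.card_sdiff_add_card_eq_card (hTGE.trans hEXN)
  have c2 : (X ∪ N).card = X.card + N.card := Finset.card_union_of_disjoint hXN
  have c3 : TG.card ≤ X.card := Finset.card_image_le.trans (Finset.card_filter_le _ _)
  have c4 := Finset.card_le_card hEXN
  have c5 : (X \ TG).card ≤ ((X ∪ N) \ TG).card :=
    Finset.card_le_card (Finset.sdiff_subset_sdiff Finset.subset_union_left subset_rfl)
  have c6 : (X \ TG).card + (X ∩ TG).card = X.card := Finset.card_sdiff_add_card_inter X TG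
  have c7 : (X ∩ TG) ⊆ insert 1 (N.image (· + 1)) := by
    intro j hj
    obtain ⟨hj1, hj2⟩ := Finset.mem_inter.1 hj
    have h1 := (hE j (hXE hj1)).1
    rcases Nat.lt_or_ge 1 j with h2 | h2
    · refine Finset.mem_insert_of_mem (Finset.mem_image.2 ⟨j - 1, (hmemN _).2 ?_, by omega⟩)
      rw [Nat.sub_add_cancel h1]
      exact ⟨by omega, hj1, hj2⟩
    · rw [le_antisymm h2 h1]
      exact Finset.mem_insert_self _ _
  have c8 := (Finset.card_le_card c7).trans (Finset.card_insert_le _ _)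
  have c9 : (N.image (· + 1)).card ≤ N.card := Finset.card_image_le
  omega

end Digraph

/-! ### The quadratic bound, from a spanning out-tree with the most leaves. -/

namespace Digraph

variable {V : Type*}

/-- The children of `w` in the spanning out-tree with root `r` and parent function `p`. -/
def children [Fintype V] [DecidableEq V] (r : V) (p : V → V) (w : V) : Finset V :=
  (Finset.univ.erase r).filter fun v => p v = w

theorem mem_children [Fintype V] [DecidableEq V] {r : V} {p : V → V} {w v : V} :
    v ∈ children r p w ↔ v ≠ r ∧ p v = w := by
  simp [children]

theorem sum_card_children [Fintype V] [DecidableEq V] (r : V) (p : V → V) :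
    ∑ w, (children r p w).card + 1 = Fintype.card V := by
  have h1 := Finset.card_eq_sum_card_fiberwise (s := Finset.univ.erase r) (t := Finset.univ) (f := p)
    fun _ _ => Finset.mem_univ _
  rw [Finset.card_erase_of_mem (Finset.mem_univ _), Finset.card_univ] at h1
  have : 0 < Fintype.card V := Fintype.card_pos_iff.2 ⟨r⟩
  simp only [children]
  omega

/-- There are fewer branching vertices than leaves. -/
theorem card_children_ne_one [Fintype V] [DecidableEq V] (r : V) (p : V → V) :
    (Finset.univ.filter fun w => (children r p w).card ≠ 1).card + 1 ≤
      2 * (treeLeaves Finset.univ r p).card := by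
  have h1 := sum_card_children r p
  -- Vertex by vertex, with c children: 2 ≤ 0 + 2 for c = 0, 1 ≤ 1 for c = 1, and 2 ≤ c otherwise.
  have h2 : ∑ w : V, (1 + if (children r p w).card ≠ 1 then 1 else 0) ≤
      ∑ w : V, ((children r p w).card + if w ∈ treeLeaves Finset.univ r p then 2 else 0) := by
    refine Finset.sum_le_sum fun w _ => ?_
    by_cases h0 : (children r p w).card = 0
    · have : w ∈ treeLeaves Finset.univ r p := by
        rw [Finset.card_eq_zero] at h0
        refine mem_treeLeaves.2 ⟨Finset.mem_univ _, fun v _ hv he => ?_⟩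
        have := mem_children.2 ⟨hv, he⟩
        simp [h0] at this
      simp [this, h0]
    · split_ifs <;> omega
  rw [Finset.sum_add_distrib, Finset.sum_add_distrib, ← Finset.sum_filter, ← Finset.sum_filter,
    Finset.filter_mem_eq_inter, Finset.univ_inter] at h2
  simp only [Finset.sum_const, smul_eq_mul, Finset.card_univ, mul_one] at h2
  omega

/-- In-degree at least `3`, or at least `2` in an oriented graph: some in-neighbour of `v` differs
from any given in-neighbour and any given out-neighbour of `v`. -/
theorem exists_inNeighbor_ne [Finite V] {D : Digraph V}
    (hdeg : (∀ v : V, 3 ≤ D.inDegree v) ∨ (D.IsOriented ∧ ∀ v : V, 2 ≤ D.inDegree v))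
    {a v b : V} (hvb : D.Adj v b) : ∃ u, D.Adj u v ∧ u ≠ a ∧ u ≠ b := by
  by_contra hcon
  push Not at hcon
  rcases hdeg with h3 | ⟨hor, h2⟩
  · have hsub : {u : V | D.Adj u v} ⊆ {a, b} := fun u hu => by
      by_cases hua : u = a
      · exact Or.inl hua
      · exact Or.inr (hcon u hu hua)
    have := (h3 v).trans (Set.ncard_le_ncard hsub (Set.toFinite _))
    have := this.trans (Set.ncard_insert_le _ _)
    simp at this
  · have hsub : {u : V | D.Adj u v} ⊆ {a} := fun u hu => by
      by_contra hua
      have := hcon u hu hua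
      subst this
      exact hor _ _ hvb hu
    have := (h2 v).trans (Set.ncard_le_ncard hsub (Set.toFinite _))
    simp at this

variable [Fintype V] [DecidableEq V] {D : Digraph V} {r : V} {p : V → V} {h : V → ℕ}

/-- A path of vertices of out-degree one in a spanning out-tree with the maximum number of leaves
has no arc that skips vertices in the direction of the path. -/
theorem IsOutTree.not_adj_of_max (hT : IsOutTree D.Adj Finset.univ r p h)
    (hmax : ∀ p' h', IsOutTree D.Adj Finset.univ r p' h' →
      (treeLeaves Finset.univ r p').card ≤ (treeLeaves Finset.univ r p).card)
    {u v : V} (hr : v ≠ r) (hv : children r p (p v) = {v}) (hu : (children r p u).Nonempty)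
    (hlt : h u < h (p v)) : ¬ D.Adj u v := by
  intro huv
  -- Rehang `v` below `u`: `p v` loses its only child and becomes a leaf, while `u` already had a
  -- child, so no leaf is lost.
  have hT' : IsOutTree D.Adj Finset.univ r (Function.update p v u) h := by
    refine ⟨Finset.mem_univ _, fun _ _ _ => Finset.mem_univ _, fun w hw hwr => ?_,
      fun w hw hwr => ?_⟩ <;> by_cases hwv : w = v
    · subst hwv; simpa using huv
    · rw [Function.update_of_ne hwv]; exact hT.adj w hw hwr
    · subst hwv; simpa using hlt.trans (hT.rank_lt w hw hwr)
    · rw [Function.update_of_ne hwv]; exact hT.rank_lt w hw hwr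
  have hpv : p v ∉ treeLeaves Finset.univ r p := fun hl =>
    (mem_treeLeaves.1 hl).2 v (Finset.mem_univ _) hr rfl
  have hsub : insert (p v) (treeLeaves Finset.univ r p) ⊆
      treeLeaves Finset.univ r (Function.update p v u) := by
    intro y hy
    refine mem_treeLeaves.2 ⟨Finset.mem_univ _, fun w hw hwr he => ?_⟩
    rcases Finset.mem_insert.1 hy with rfl | hy
    · by_cases hwv : w = v
      · subst hwv
        rw [Function.update_self] at he
        rw [he] at hlt
        exact lt_irrefl _ hlt
      · rw [Function.update_of_ne hwv] at he
        have := mem_children.2 ⟨hwr, he⟩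
        rw [hv, Finset.mem_singleton] at this
        exact hwv this
    · have hy' := (mem_treeLeaves.1 hy).2
      by_cases hwv : w = v
      · subst hwv
        rw [Function.update_self] at he
        obtain ⟨z, hz⟩ := hu
        obtain ⟨hz, hz'⟩ := mem_children.1 hz
        exact hy' z (Finset.mem_univ _) hz (hz'.trans he)
      · rw [Function.update_of_ne hwv] at he
        exact hy' w hw hwr he
  have h1 := Finset.card_le_card hsub
  rw [Finset.card_insert_of_notMem hpv] at h1
  have := hmax _ _ hT'
  omega

/-- In a spanning out-tree with the maximum number of leaves, the length of a path of vertices of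
out-degree one is linear in the number of leaves of an out-tree. -/
theorem IsOutTree.path_length_le (hT : IsOutTree D.Adj Finset.univ r p h)
    (hloopless : ∀ v : V, ¬ D.Adj v v)
    (hdeg : (∀ v : V, 3 ≤ D.inDegree v) ∨ (D.IsOriented ∧ ∀ v : V, 2 ≤ D.inDegree v))
    (hmax : ∀ p' h', IsOutTree D.Adj Finset.univ r p' h' →
      (treeLeaves Finset.univ r p').card ≤ (treeLeaves Finset.univ r p).card)
    {K : ℕ} (hK : ∀ S r p h, IsOutTree D.Adj S r p h → (treeLeaves S r p).card ≤ K)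
    {w : V} {s : ℕ} (hs : ∀ b < s, children r p (p^[b + 1] w) = {p^[b] w}) :
    s ≤ 6 * K + 3 := by
  classical
  set x : ℕ → V := fun b => p^[b] w with hx
  have hxs : ∀ b, p (x b) = x (b + 1) := fun b => (Function.iterate_succ_apply' p b w).symm
  have hch : ∀ b < s, children r p (x (b + 1)) = {x b} := hs
  have hxr : ∀ b < s, x b ≠ r := fun b hb => by
    have : x b ∈ children r p (x (b + 1)) := by rw [hch b hb]; exact Finset.mem_singleton_self _
    exact (mem_children.1 this).1
  have hadj : ∀ b < s, D.Adj (x (b + 1)) (x b) := fun b hb =>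
    hxs b ▸ hT.adj _ (Finset.mem_univ _) (hxr b hb)
  have hrank : ∀ i j, i < j → j ≤ s → h (x j) < h (x i) := by
    intro i j hij
    induction j, hij using Nat.le_induction with
    | base => exact fun hj => hxs i ▸ hT.rank_lt _ (Finset.mem_univ _) (hxr i hj)
    | succ j hij ih =>
      exact fun hj => (hxs j ▸ hT.rank_lt _ (Finset.mem_univ _) (hxr j hj)).trans (ih (by omega))
  have hinj : Set.InjOn x (Set.Icc 1 s) := by
    intro i hi j hj he
    rcases lt_trichotomy i j with hij | hij | hij
    · have := hrank i j hij hj.2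
      rw [he] at this
      exact absurd this (lt_irrefl _)
    · exact hij
    · have := hrank j i hij hi.2
      rw [he] at this
      exact absurd this (lt_irrefl _)
  have hjump : ∀ i j, i + 2 ≤ j → j ≤ s → ¬ D.Adj (x j) (x i) := by
    intro i j hij hj
    refine hT.not_adj_of_max hmax (hxr i (by omega)) ?_ ?_ ?_
    · rw [hxs i, hch i (by omega)]
    · obtain ⟨j, rfl⟩ : ∃ j', j = j' + 1 := ⟨j - 1, by omega⟩
      rw [hch j (by omega)]
      exact Finset.singleton_nonempty _
    · rw [hxs i]
      exact hrank _ _ (by omega) hj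
  -- `W` is the subtree below the end `w` of the chain, and `Q` is what remains of the tree off `W`
  -- and the chain. Both, when nonempty, are out-trees that avoid `x 1, …, x s`.
  set W : Finset V := Finset.univ.filter fun v =>
    Relation.ReflTransGen (fun a b => b ≠ r ∧ p b = a) w v with hW
  have hmemW : ∀ v, v ∈ W ↔ Relation.ReflTransGen (fun a b => b ≠ r ∧ p b = a) w v := by
    simp [hW]
  have hWp : ∀ v ∈ W, v ≠ w → v ≠ r ∧ p v ∈ W := by
    intro v hv hvw
    rcases Relation.ReflTransGen.cases_tail ((hmemW v).1 hv) with he | ⟨u, hu, hv, rfl⟩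
    · exact absurd he hvw
    · exact ⟨hv, (hmemW _).2 hu⟩
  have hWchild : ∀ v, v ≠ r → p v ∈ W → v ∈ W := fun v hv hp =>
    (hmemW v).2 (((hmemW _).1 hp).tail ⟨hv, rfl⟩)
  have hTW : IsOutTree D.Adj W w p h :=
    ⟨(hmemW w).2 .refl, fun v hv hvw => (hWp v hv hvw).2,
      fun v hv hvw => hT.adj v (Finset.mem_univ _) (hWp v hv hvw).1,
      fun v hv hvw => hT.rank_lt v (Finset.mem_univ _) (hWp v hv hvw).1⟩
  have hxW : ∀ i, 1 ≤ i → i ≤ s → x i ∉ W := by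
    intro i h1 h2 hi
    have hge : ∀ v, Relation.ReflTransGen (fun a b => b ≠ r ∧ p b = a) w v → h w ≤ h v := by
      intro v hv
      induction hv with
      | refl => exact le_rfl
      | tail _ hab ih =>
        have := hT.rank_lt _ (Finset.mem_univ _) hab.1
        rw [hab.2] at this
        exact ih.trans this.le
    exact absurd (hrank 0 i h1 h2) (not_lt.2 (hge _ ((hmemW _).1 hi)))
  set Q : Finset V := Finset.univ \ (W ∪ (Finset.Icc 1 s).image x) with hQ
  have hmemQ : ∀ v, v ∈ Q ↔ v ∉ W ∧ ∀ i, 1 ≤ i → i ≤ s → x i ≠ v := by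
    intro v
    simp [hQ]
  have hQp : ∀ v ∈ Q, v ≠ r → p v ∈ Q := by
    intro v hv hr
    obtain ⟨h1, h2⟩ := (hmemQ v).1 hv
    refine (hmemQ _).2 ⟨fun hp => h1 (hWchild v hr hp), fun i hi his he => ?_⟩
    obtain ⟨i, rfl⟩ : ∃ i', i = i' + 1 := ⟨i - 1, by omega⟩
    have hv' : v ∈ children r p (x (i + 1)) := mem_children.2 ⟨hr, he.symm⟩
    rw [hch i (by omega), Finset.mem_singleton] at hv'
    rcases Nat.eq_zero_or_pos i with rfl | hi0
    · exact h1 (hv' ▸ hTW.root_mem)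
    · exact h2 i hi0 (by omega) hv'.symm
  have hQr : ∀ v ∈ Q, r ∈ Q := by
    intro v hv
    induction hn : h v using Nat.strong_induction_on generalizing v with
    | _ n ih =>
      by_cases hr : v = r
      · exact hr ▸ hv
      · exact ih _ (hn ▸ hT.rank_lt v (Finset.mem_univ _) hr) _ (hQp v hv hr) rfl
  -- `A j i` is a backward jump; `E S` consists of the indices reached by such jumps after one arc
  -- from `S`.
  set A : ℕ → ℕ → Prop := fun j i => 1 ≤ j ∧ j + 2 ≤ i ∧ i < s ∧ D.Adj (x j) (x i) with hA
  set E : Finset V → Finset ℕ := fun S => (Finset.Ico 1 s).filter fun i =>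
    ∃ b, (1 ≤ b ∧ b < s ∧ ∃ u ∈ S, D.Adj u (x b)) ∧ Relation.ReflTransGen A b i with hEdef
  have hmemE : ∀ S i, i ∈ E S ↔ (1 ≤ i ∧ i < s) ∧
      ∃ b, (1 ≤ b ∧ b < s ∧ ∃ u ∈ S, D.Adj u (x b)) ∧ Relation.ReflTransGen A b i := by
    simp [hEdef]
  have hEcard : ∀ S r' p' h', IsOutTree D.Adj S r' p' h' → (∀ i, 1 ≤ i → i ≤ s → x i ∉ S) →
      (E S).card ≤ 3 * K + 1 := by
    intro S r' p' h' hS hxS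
    have hpar : ∀ i ∈ E S, (∃ u ∈ S, D.Adj u (x i)) ∨
        ∃ j ∈ E S, j + 2 ≤ i ∧ D.Adj (x j) (x i) := by
      intro i hi
      obtain ⟨-, b, hb, hbi⟩ := (hmemE S i).1 hi
      rcases Relation.ReflTransGen.cases_tail hbi with rfl | ⟨j, hbj, hji⟩
      · exact Or.inl hb.2.2
      · exact Or.inr ⟨j, (hmemE S j).2 ⟨⟨hji.1, by have := hji.2; omega⟩, b, hb, hbj⟩,
          hji.2.1, hji.2.2.2⟩
    obtain ⟨S', p'', h'', h1, h2⟩ := hS.attach_path x s hinj hxS (fun i _ hi => hadj i hi) (E S)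
      (fun i hi => by have := ((hmemE S i).1 hi).1; omega) hpar
    have := hK _ _ _ _ h1
    omega
  -- The extra in-neighbour, if on the chain, has index smaller by at least two: forward jumps
  -- contradict maximality, and the two chain neighbours and loops are excluded. So strong induction
  -- on the index applies.
  have hcover : Finset.Ico 1 s ⊆ E W ∪ E Q := by
    intro i
    induction i using Nat.strong_induction_on with
    | _ i ih =>
      intro hi
      obtain ⟨hi1, his⟩ := Finset.mem_Ico.1 hi
      obtain ⟨i, rfl⟩ : ∃ i', i = i' + 1 := ⟨i - 1, by omega⟩
      obtain ⟨u, hu, hu1, hu2⟩ := exists_inNeighbor_ne hdeg (a := x (i + 2)) (hadj i (by omega))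
      by_cases huW : u ∈ W
      · exact Finset.mem_union_left _ ((hmemE _ _).2
          ⟨⟨hi1, his⟩, _, ⟨hi1, his, u, huW, hu⟩, .refl⟩)
      by_cases huQ : u ∈ Q
      · exact Finset.mem_union_right _ ((hmemE _ _).2
          ⟨⟨hi1, his⟩, _, ⟨hi1, his, u, huQ, hu⟩, .refl⟩)
      have : ∃ j, 1 ≤ j ∧ j ≤ s ∧ x j = u := by
        by_contra hcon
        push Not at hcon
        exact huQ ((hmemQ u).2 ⟨huW, hcon⟩)
      obtain ⟨j, hj1, hjs, rfl⟩ := this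
      have hj3 : ¬ i + 3 ≤ j := fun hj => hjump (i + 1) j hj hjs hu
      have hj2 : j ≠ i + 2 := fun he => hu1 (by rw [he])
      have hj1' : j ≠ i + 1 := fun he => hloopless _ (he ▸ hu)
      have hj0 : j ≠ i := fun he => hu2 (by rw [he])
      have hAj : A j (i + 1) := ⟨hj1, by omega, his, hu⟩
      rcases Finset.mem_union.1 (ih j (by omega) (Finset.mem_Ico.2 ⟨hj1, by omega⟩)) with hj | hj
      · obtain ⟨-, b, hb, hbj⟩ := (hmemE _ _).1 hj
        exact Finset.mem_union_left _ ((hmemE _ _).2 ⟨⟨hi1, his⟩, b, hb, hbj.tail hAj⟩)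
      · obtain ⟨-, b, hb, hbj⟩ := (hmemE _ _).1 hj
        exact Finset.mem_union_right _ ((hmemE _ _).2 ⟨⟨hi1, his⟩, b, hb, hbj.tail hAj⟩)
  have hW1 := hEcard W w p h hTW hxW
  have hQ1 : (E Q).card ≤ 3 * K + 1 := by
    by_cases hne : Q.Nonempty
    · obtain ⟨v, hv⟩ := hne
      exact hEcard Q r p h ⟨hQr v hv, hQp, fun v _ hr => hT.adj v (Finset.mem_univ _) hr,
        fun v _ hr => hT.rank_lt v (Finset.mem_univ _) hr⟩
        fun i h1 h2 hi => ((hmemQ _).1 hi).2 i h1 h2 rfl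
    · have : E Q = ∅ := by
        refine Finset.eq_empty_of_forall_notMem fun i hi => ?_
        obtain ⟨-, b, ⟨-, -, u, hu, -⟩, -⟩ := (hmemE _ _).1 hi
        exact hne ⟨u, hu⟩
      simp [this]
  have := (Finset.card_le_card hcover).trans (Finset.card_union_le _ _)
  rw [Nat.card_Ico] at this
  omega

/-- A digraph with a spanning out-tree, whose out-trees have at most `K` leaves, has at most
`16 * K ^ 2` vertices. -/
theorem IsOutTree.card_le (hT : IsOutTree D.Adj Finset.univ r p h)
    (hloopless : ∀ v : V, ¬ D.Adj v v)
    (hdeg : (∀ v : V, 3 ≤ D.inDegree v) ∨ (D.IsOriented ∧ ∀ v : V, 2 ≤ D.inDegree v))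
    {K : ℕ} (hK : ∀ S r p h, IsOutTree D.Adj S r p h → (treeLeaves S r p).card ≤ K) :
    Fintype.card V ≤ 16 * K ^ 2 := by
  classical
  obtain ⟨p, h, hT, hmax⟩ : ∃ p h, IsOutTree D.Adj Finset.univ r p h ∧
      ∀ p' h', IsOutTree D.Adj Finset.univ r p' h' →
        (treeLeaves Finset.univ r p').card ≤ (treeLeaves Finset.univ r p).card := by
    by_contra hcon
    push Not at hcon
    have : ∀ n, ∃ p h, IsOutTree D.Adj Finset.univ r p h ∧
        n ≤ (treeLeaves Finset.univ r p).card := by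
      intro n
      induction n with
      | zero => exact ⟨p, h, hT, Nat.zero_le _⟩
      | succ n ih =>
        obtain ⟨p, h, hT, hn⟩ := ih
        obtain ⟨p', h', hT', hlt⟩ := hcon p h hT
        exact ⟨p', h', hT', by omega⟩
    obtain ⟨p', h', hT', hn⟩ := this (K + 1)
    have := hK _ _ _ _ hT'
    omega
  -- `F w` is the chain of one-child ancestors ending at `w`. Descending through only children from
  -- any vertex stops at some `w ∈ B` whose chain contains it.
  set F : V → Finset V := fun w => Finset.univ.filter fun v =>
    ∃ a, p^[a] w = v ∧ ∀ b < a, children r p (p^[b + 1] w) = {p^[b] w} with hF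
  have hFcard : ∀ w, (F w).card ≤ 6 * K + 4 := by
    intro w
    have : F w ⊆ (Finset.range (6 * K + 4)).image fun a => p^[a] w := by
      intro v hv
      obtain ⟨a, rfl, ha⟩ := (Finset.mem_filter.1 hv).2
      have := hT.path_length_le hloopless hdeg hmax hK ha
      exact Finset.mem_image_of_mem (fun a => p^[a] w) (Finset.mem_range.2 (by omega))
    exact (Finset.card_le_card this).trans (Finset.card_image_le.trans (Finset.card_range _).le)
  set B := Finset.univ.filter fun w => (children r p w).card ≠ 1 with hB
  have hcover : ∀ v, ∃ w ∈ B, v ∈ F w := by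
    intro v
    induction hn : Finset.univ.sup h - h v using Nat.strong_induction_on generalizing v with
    | _ n ih =>
      by_cases hv : (children r p v).card = 1
      · obtain ⟨c, hc⟩ := Finset.card_eq_one.1 hv
        have hcv : c ∈ children r p v := by rw [hc]; exact Finset.mem_singleton_self _
        obtain ⟨hcr, hpc⟩ := mem_children.1 hcv
        have h1 := hT.rank_lt c (Finset.mem_univ _) hcr
        have h2 := Finset.le_sup (f := h) (Finset.mem_univ c)
        rw [hpc] at h1
        obtain ⟨w, hw, hcw⟩ := ih _ (by omega) c rfl
        refine ⟨w, hw, Finset.mem_filter.2 ⟨Finset.mem_univ _, ?_⟩⟩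
        obtain ⟨a, ha, hb⟩ := (Finset.mem_filter.1 hcw).2
        refine ⟨a + 1, by rw [Function.iterate_succ_apply', ha, hpc], fun b hba => ?_⟩
        rcases Nat.lt_succ_iff_lt_or_eq.1 hba with hba | rfl
        · exact hb b hba
        · rw [Function.iterate_succ_apply', ha, hpc, hc]
      · exact ⟨v, Finset.mem_filter.2 ⟨Finset.mem_univ _, hv⟩,
          Finset.mem_filter.2 ⟨Finset.mem_univ _, 0, rfl, fun b hb => absurd hb (Nat.not_lt_zero b)⟩⟩
  have h1 : Fintype.card V ≤ B.card * (6 * K + 4) := by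
    rw [← Finset.card_univ]
    have : (Finset.univ : Finset V) ⊆ B.biUnion F := fun v _ => Finset.mem_biUnion.2 (hcover v)
    exact (Finset.card_le_card this).trans (Finset.card_biUnion_le_card_mul _ _ _ fun w _ => hFcard w)
  have h2 : B.card + 1 ≤ 2 * (treeLeaves Finset.univ r p).card := by
    convert card_children_ne_one r p
  have h3 := hK _ _ _ _ hT
  -- The product is at most (2K - 1)(6K + 4) = 12K² + 2K - 4 ≤ 16K².
  obtain ⟨c, hc⟩ : ∃ c, 2 * K = B.card + 1 + c := ⟨2 * K - (B.card + 1), by omega⟩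
  nlinarith [Nat.zero_le c, Nat.zero_le (c * K), sq_nonneg ((K : ℤ) - 1)]

end Digraph

/-! ### Dominators, and comparing out-trees with spanning out-trees. -/

namespace Digraph

open Relation

variable {V : Type*} {A : V → V → Prop} {r : V}

/-- Every walk from `r` to `v` passes through `a`. -/
def Dominates (A : V → V → Prop) (r a v : V) : Prop :=
  a = r ∨ ¬ ReflTransGen (fun x y => A x y ∧ y ≠ a) r v

theorem reflTransGen_of_imp {B : V → V → Prop} {u v : V} (hAB : ∀ x y, A x y → B x y)
    (h : ReflTransGen A u v) : ReflTransGen B u v :=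
  ReflTransGen.mono hAB _ _ h

theorem not_dominates_iff {a v : V} : ¬ Dominates A r a v ↔
    a ≠ r ∧ ReflTransGen (fun x y => A x y ∧ y ≠ a) r v := by
  simp [Dominates]

/-- The restricted relation forbids only entering `a`, not starting there; this is why `Dominates`
treats `a = r` separately. -/
theorem reflTransGen_avoiding_self {a : V} (ha : a ≠ r) :
    ¬ ReflTransGen (fun x y => A x y ∧ y ≠ a) r a := by
  intro h
  rcases ReflTransGen.cases_tail h with he | ⟨_, -, -, hne⟩
  · exact ha he
  · exact hne rfl

/-- Cut the walk just before it first enters `a`. -/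
theorem reflTransGen_avoiding_or {a y : V} (h : ReflTransGen A r y) :
    ReflTransGen (fun x y => A x y ∧ y ≠ a) r y ∨
      ∃ u, ReflTransGen (fun x y => A x y ∧ y ≠ a) r u ∧ A u a := by
  induction h with
  | refl => exact Or.inl .refl
  | @tail b c _ hbc ih =>
    rcases ih with ih | ih
    · by_cases hc : c = a
      · subst hc; exact Or.inr ⟨b, ih, hbc⟩
      · exact Or.inl (ih.tail ⟨hbc, hc⟩)
    · exact Or.inr ih

theorem dominates_self (A : V → V → Prop) (r a : V) : Dominates A r a a := by
  by_contra h
  obtain ⟨h1, h2⟩ := not_dominates_iff.1 h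
  exact reflTransGen_avoiding_self h1 h2

theorem Dominates.of_adj {a u v : V} (h : Dominates A r a v) (huv : A u v) (hv : v ≠ a) :
    Dominates A r a u := by
  by_contra hcon
  obtain ⟨h1, h2⟩ := not_dominates_iff.1 hcon
  exact not_dominates_iff.2 ⟨h1, h2.tail ⟨huv, hv⟩⟩ h

theorem Dominates.trans {a b v : V} (hab : Dominates A r a b) (hbv : Dominates A r b v) :
    Dominates A r a v := by
  by_contra hcon
  obtain ⟨h1, h2⟩ := not_dominates_iff.1 hcon
  have hb : b ≠ r := by
    rintro rfl
    exact not_dominates_iff.2 ⟨h1, .refl⟩ hab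
  have key : ReflTransGen (fun x y => A x y ∧ y ≠ b) r v := by
    clear hbv hcon
    induction h2 with
    | refl => exact .refl
    | @tail c d hc hcd ih =>
      refine ih.tail ⟨hcd.1, ?_⟩
      rintro rfl
      exact not_dominates_iff.2 ⟨h1, hc.tail hcd⟩ hab
  exact not_dominates_iff.2 ⟨hb, key⟩ hbv

/-- If neither dominates the other, then along a walk to `v` each vertex can be reached avoiding `a`
or avoiding `b`: the one that avoids may switch only at `a` or `b`, where the assumption restores
it. -/
theorem Dominates.total {a b v : V} (hr : ReflTransGen A r v) (ha : Dominates A r a v)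
    (hb : Dominates A r b v) : Dominates A r a b ∨ Dominates A r b a := by
  by_contra hcon
  push Not at hcon
  obtain ⟨h1, h2⟩ := hcon
  have key : ¬ Dominates A r a v ∨ ¬ Dominates A r b v := by
    clear ha hb
    induction hr with
    | refl => exact Or.inl (not_dominates_iff.2 ⟨(not_dominates_iff.1 h1).1, .refl⟩)
    | @tail c d _ hcd ih =>
      by_cases hda : d = a
      · subst hda; exact Or.inr h2
      by_cases hdb : d = b
      · subst hdb; exact Or.inl h1
      exact ih.imp (fun h hd => h (hd.of_adj hcd hda)) (fun h hd => h (hd.of_adj hcd hdb))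
  exact key.elim (fun h => h ha) (fun h => h hb)

/-- Whichever of two distinct vertices a walk from `r` enters first was reached without the other.
-/
theorem Dominates.antisymm {a b : V} (hr : ReflTransGen A r a) (hab : Dominates A r a b)
    (hba : Dominates A r b a) (ha : a ≠ r) (hb : b ≠ r) : a = b := by
  by_contra hne
  have key : ∀ v, ReflTransGen A r v →
      ReflTransGen (fun x y => (A x y ∧ y ≠ a) ∧ y ≠ b) r v := by
    intro v hv
    induction hv with
    | refl => exact .refl
    | @tail c d _ hcd ih =>
      refine ih.tail ⟨⟨hcd, ?_⟩, ?_⟩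
      · rintro rfl
        exact not_dominates_iff.2
          ⟨hb, (reflTransGen_of_imp (fun _ _ h => ⟨h.1.1, h.2⟩) ih).tail ⟨hcd, hne⟩⟩ hba
      · rintro rfl
        exact not_dominates_iff.2
          ⟨ha, (reflTransGen_of_imp (fun _ _ h => h.1) ih).tail ⟨hcd, fun h => hne h.symm⟩⟩ hab
  exact reflTransGen_avoiding_self ha (reflTransGen_of_imp (fun _ _ h => h.1) (key a hr))

variable [Fintype V] [DecidableEq V]

/-- Some out-tree through `s` meets `L` in few vertices, apart from those that dominate `s`. -/
theorem exists_isOutTree_card_inter_le (hr : ∀ v, ReflTransGen A r v) (L : Finset V) (hL : r ∉ L)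
    (s : V) (I : Finset V) (hI : ∀ a, a ∈ I ↔ a ∈ L ∧ Dominates A r a s) :
    ∃ Y p h, IsOutTree A Y r p h ∧ s ∈ Y ∧ 2 * (Y ∩ L).card ≤ L.card + I.card := by
  classical
  have hex : ∀ v, ∃ n, ∃ Y p h, IsOutTree A Y r p h ∧ v ∈ Y ∧ (Y ∩ L).card = n := fun v => by
    obtain ⟨p, h, hT, -⟩ := (IsOutTree.singleton A r).exists_spanning hr
    exact ⟨_, _, _, _, hT, Finset.mem_univ v, rfl⟩
  -- `d v` is the least number of vertices of `L` on an out-tree from `r` through `v`. Along an arc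
  -- it rises by at most one, and only when the head is in `L`; so every walk to `s` enters a vertex
  -- of `L` at each level 1, …, `d s`.
  set d : V → ℕ := fun v => Nat.find (hex v) with hd
  have hdr : d r = 0 := by
    refine Nat.le_zero.1 (Nat.find_min' (hex r) ⟨_, _, _, IsOutTree.singleton A r, by simp, ?_⟩)
    simp [hL]
  have hdstep : ∀ u v, A u v → d v ≤ d u ∨ (v ∈ L ∧ d v ≤ d u + 1) := by
    intro u v huv
    obtain ⟨Y, p, h, hT, hu, hc⟩ := Nat.find_spec (hex u)
    change _ = d u at hc
    by_cases hv : v ∈ Y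
    · exact Or.inl (hc ▸ Nat.find_min' (hex v) ⟨Y, p, h, hT, hv, rfl⟩)
    have hle : d v ≤ (insert v Y ∩ L).card :=
      Nat.find_min' (hex v) ⟨_, _, _, hT.insert_vertex hu hv huv, Finset.mem_insert_self _ _, rfl⟩
    by_cases hvL : v ∈ L
    · rw [Finset.insert_inter_of_mem hvL] at hle
      have := Finset.card_insert_le v (Y ∩ L)
      exact Or.inr ⟨hvL, by omega⟩
    · rw [Finset.insert_inter_of_notMem hvL] at hle
      exact Or.inl (by omega)
  have hcross : ∀ B : V → V → Prop, (∀ u v, B u v → A u v) → ∀ y, ReflTransGen B r y →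
      ∀ j, 1 ≤ j → j ≤ d y → ∃ v ∈ L, d v = j ∧ ∃ u, B u v := by
    intro B hB y hy j hj
    induction hy with
    | refl => intro h; omega
    | @tail b c _ hbc ih =>
      intro hc
      rcases Nat.lt_or_ge (d b) j with hlt | hge
      · rcases hdstep b c (hB _ _ hbc) with h | ⟨hcL, h⟩
        · omega
        · exact ⟨c, hcL, by omega, b, hbc⟩
      · exact ih hge
  -- Each level has weight at least two: either its vertex dominates `s` and counts double, or a
  -- walk avoiding that vertex meets a second one.
  set wt : V → ℕ := fun x => 1 + if x ∈ I then 1 else 0 with hwt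
  have hlevel : ∀ j ∈ Finset.Icc 1 (d s), 2 ≤ ∑ x ∈ L.filter (fun x => d x = j), wt x := by
    intro j hj
    obtain ⟨hj1, hj2⟩ := Finset.mem_Icc.1 hj
    obtain ⟨x, hxL, hxj, -⟩ := hcross A (fun _ _ h => h) s (hr s) j hj1 hj2
    have hxm : x ∈ L.filter (fun x => d x = j) := Finset.mem_filter.2 ⟨hxL, hxj⟩
    by_cases hx : Dominates A r x s
    · calc 2 = wt x := by simp [hwt, (hI x).2 ⟨hxL, hx⟩]
        _ ≤ _ := Finset.single_le_sum (f := wt) (fun _ _ => Nat.zero_le _) hxm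
    · obtain ⟨y, hyL, hyj, u, -, hyx⟩ := hcross (fun u v => A u v ∧ v ≠ x) (fun _ _ h => h.1) s
        (not_dominates_iff.1 hx).2 j hj1 hj2
      have hym : y ∈ L.filter (fun x => d x = j) := Finset.mem_filter.2 ⟨hyL, hyj⟩
      calc 2 = ({y, x} : Finset V).card := (Finset.card_pair hyx).symm
        _ ≤ (L.filter (fun x => d x = j)).card :=
          Finset.card_le_card (Finset.insert_subset hym (Finset.singleton_subset_iff.2 hxm))
        _ = ∑ x ∈ L.filter (fun x => d x = j), 1 := Finset.card_eq_sum_ones _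
        _ ≤ _ := Finset.sum_le_sum fun _ _ => Nat.le_add_right _ _
  have hsum : ∑ x ∈ L, wt x = L.card + I.card := by
    rw [hwt, Finset.sum_add_distrib, ← Finset.card_eq_sum_ones, ← Finset.sum_filter,
      ← Finset.card_eq_sum_ones, Finset.filter_mem_eq_inter,
      Finset.inter_eq_right.2 fun a ha => ((hI a).1 ha).1]
  have hlev : 2 * d s ≤ ∑ x ∈ L, wt x := by
    calc 2 * d s = ∑ _j ∈ Finset.Icc 1 (d s), 2 := by simp [mul_comm]
      _ ≤ ∑ j ∈ Finset.Icc 1 (d s), ∑ x ∈ L.filter (fun x => d x = j), wt x :=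
        Finset.sum_le_sum hlevel
      _ = ∑ x ∈ (Finset.Icc 1 (d s)).biUnion (fun j => L.filter (fun x => d x = j)), wt x := by
        refine (Finset.sum_biUnion fun i _ j _ hij => ?_).symm
        refine Finset.disjoint_left.2 fun x hx hx' => hij ?_
        rw [← (Finset.mem_filter.1 hx).2, (Finset.mem_filter.1 hx').2]
      _ ≤ _ := Finset.sum_le_sum_of_subset
        (Finset.biUnion_subset.2 fun j _ => Finset.filter_subset _ _)
  obtain ⟨Y, p, h, hT, hs, hc⟩ := Nat.find_spec (hex s)
  change _ = d s at hc
  exact ⟨Y, p, h, hT, hs, by omega⟩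

/-- If `I` consists of dominators of `s` and there is, in each layer between consecutive elements
of `I`, a vertex that does not dominate the next element of `I`, then some spanning out-tree has a
leaf in every layer. -/
theorem exists_spanning_card_dominators_le (hr : ∀ v, ReflTransGen A r v) {s : V} {I : Finset V}
    (hrI : r ∉ I) (hI : ∀ a ∈ I, Dominates A r a s) (Δ : V → Finset V)
    (hΔ : ∀ a v, a ∈ Δ v ↔ a ∈ I ∧ Dominates A r a v) (z : V → V)
    (hz : ∀ a ∈ I, Δ (z a) = (Δ a).erase a) (hzI : ∀ a ∈ I, z a ∉ I) (hzr : ∀ a ∈ I, z a ≠ r)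
    (hza : ∀ a ∈ I, ¬ Dominates A r (z a) a) :
    ∃ p h, IsOutTree A Finset.univ r p h ∧ I.card ≤ (treeLeaves Finset.univ r p).card := by
  have hself : ∀ a ∈ I, a ∈ Δ a := fun a ha => (hΔ a a).2 ⟨ha, dominates_self A r a⟩
  have hstep : ∀ u v, A u v → Δ v ⊆ insert v (Δ u) := by
    intro u v huv a ha
    obtain ⟨haI, had⟩ := (hΔ a v).1 ha
    by_cases hv : v = a
    · subst hv; exact Finset.mem_insert_self _ _
    · exact Finset.mem_insert_of_mem ((hΔ a u).2 ⟨haI, had.of_adj huv hv⟩)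
  have hstep' : ∀ u v, A u v → v ∉ I → Δ v ⊆ Δ u := by
    intro u v huv hv a ha
    refine (Finset.mem_insert.1 (hstep u v huv ha)).resolve_left ?_
    rintro rfl
    exact hv ((hΔ _ _).1 ha).1
  have htotal : ∀ a ∈ I, ∀ b ∈ I, Dominates A r a b ∨ Dominates A r b a := fun a ha b hb =>
    (hI a ha).total (hr s) (hI b hb)
  have hsub : ∀ b ∈ I, ∀ v, ¬ Dominates A r b v → Δ v ⊆ (Δ b).erase b := by
    intro b hb v hbv a ha
    obtain ⟨haI, hav⟩ := (hΔ a v).1 ha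
    refine Finset.mem_erase.2 ⟨?_, (hΔ a b).2 ⟨haI, ?_⟩⟩
    · rintro rfl; exact hbv hav
    · exact (htotal a haI b hb).resolve_right fun h => hbv (h.trans hav)
  have hΔinj : ∀ a ∈ I, ∀ b ∈ I, (Δ a).erase a = (Δ b).erase b → a = b := by
    intro a ha b hb he
    by_contra hne
    rcases htotal a ha b hb with h | h
    · have : a ∈ (Δ b).erase b := Finset.mem_erase.2 ⟨hne, (hΔ a b).2 ⟨ha, h⟩⟩
      rw [← he] at this
      simp at this
    · have : b ∈ (Δ a).erase a := Finset.mem_erase.2 ⟨fun h => hne h.symm, (hΔ b a).2 ⟨hb, h⟩⟩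
      rw [he] at this
      simp at this
  -- The fibres of `Δ` are the layers. `H` keeps the arcs along which no dominator is lost, and `HZ`
  -- also avoids the chosen vertices `z a`.
  set H : V → V → Prop := fun u v => A u v ∧ Δ u ⊆ Δ v with hH
  set HZ : V → V → Prop := fun u v => H u v ∧ ∀ a ∈ I, v ≠ z a with hHZ
  have hΔr : Δ r = ∅ := by
    refine Finset.eq_empty_of_forall_notMem fun a ha => ?_
    obtain ⟨haI, had⟩ := (hΔ a r).1 ha
    have har : a ≠ r := fun h => hrI (h ▸ haI)
    exact not_dominates_iff.2 ⟨har, .refl⟩ had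
  have hHreach : ∀ v, ReflTransGen H r v := by
    intro v
    induction hn : (Δ v).card using Nat.strong_induction_on generalizing v with
    | _ n ih =>
      have hpath : ReflTransGen (fun x y => A x y ∧ Δ y ⊆ Δ v) r v := by
        by_cases hIv : I ⊆ Δ v
        · exact reflTransGen_of_imp
            (fun x y hxy => ⟨hxy, fun a ha => hIv ((hΔ a y).1 ha).1⟩) (hr v)
        -- `b` is the first member of `I` that does not dominate `v`; a walk to `v` avoiding `b`
        -- stays within layers up to that of `v`.
        obtain ⟨b, hb, hbmin⟩ := (I \ Δ v).exists_min_image (fun b => (Δ b).card)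
          (Finset.sdiff_nonempty.2 hIv)
        obtain ⟨hbI, hbv⟩ := Finset.mem_sdiff.1 hb
        have hbd : ¬ Dominates A r b v := fun h => hbv ((hΔ b v).2 ⟨hbI, h⟩)
        have hbsub : (Δ b).erase b ⊆ Δ v := by
          intro c hc
          obtain ⟨hcb, hc⟩ := Finset.mem_erase.1 hc
          obtain ⟨hcI, hcd⟩ := (hΔ c b).1 hc
          by_contra hcv
          refine absurd (hbmin c (Finset.mem_sdiff.2 ⟨hcI, hcv⟩)) (not_le.2 ?_)
          refine Finset.card_lt_card ⟨fun e he => (hΔ e b).2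
            ⟨((hΔ e c).1 he).1, ((hΔ e c).1 he).2.trans hcd⟩, fun h => hcb ?_⟩
          have hbc := ((hΔ b c).1 (h (hself b hbI))).2
          exact hcd.antisymm (hr c) hbc (fun h => hrI (h ▸ hcI)) (fun h => hrI (h ▸ hbI))
        obtain ⟨hbr, hbp⟩ := not_dominates_iff.1 hbd
        have hall : ∀ y, ReflTransGen (fun x y => A x y ∧ y ≠ b) r y →
            ReflTransGen (fun x y => A x y ∧ Δ y ⊆ Δ v) r y := by
          intro y hy
          induction hy with
          | refl => exact .refl
          | @tail c e hc hce ihc =>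
            exact ihc.tail ⟨hce.1,
              (hsub b hbI e (not_dominates_iff.2 ⟨hbr, hc.tail hce⟩)).trans hbsub⟩
        exact hall v hbp
      have hall : ∀ y, ReflTransGen (fun x y => A x y ∧ Δ y ⊆ Δ v) r y →
          Δ y ⊆ Δ v ∧ ReflTransGen H r y := by
        intro y hy
        induction hy with
        | refl => exact ⟨by simp [hΔr], .refl⟩
        | @tail c e _ hce ihc =>
          refine ⟨hce.2, ?_⟩
          by_cases he : Δ e = Δ v
          · exact ihc.2.tail ⟨hce.1, he ▸ ihc.1⟩
          · exact ih _ (hn ▸ Finset.card_lt_card (hce.2.ssubset_of_ne he)) e rfl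
      exact (hall v hpath).2
  -- Take a walk to `a` that avoids `z a`, cut before its first visit to `a`. It can enter the last
  -- layer before `a` only through a member of `I`, which is covered by induction; inside that layer
  -- the only excluded vertex is `z a`.
  have hHZreach : ∀ a ∈ I, ReflTransGen HZ r a := by
    intro a
    induction hn : (Δ a).card using Nat.strong_induction_on generalizing a with
    | _ n ih =>
      intro ha
      have har : a ≠ r := fun h => hrI (h ▸ ha)
      obtain ⟨-, hpath⟩ := not_dominates_iff.1 (hza a ha)
      have hall : ∀ y, ReflTransGen (fun x y => (A x y ∧ y ≠ z a) ∧ y ≠ a) r y →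
          Δ y ⊆ (Δ a).erase a ∧ (Δ y = (Δ a).erase a → ReflTransGen HZ r y) := by
        intro y hy
        induction hy with
        | refl => exact ⟨by simp [hΔr], fun _ => .refl⟩
        | @tail c e hc hce ihc =>
          refine ⟨hsub a ha e (not_dominates_iff.2
            ⟨har, reflTransGen_of_imp (fun _ _ h => ⟨h.1.1, h.2⟩) (hc.tail hce)⟩), fun he => ?_⟩
          by_cases hcΔ : Δ c = (Δ a).erase a
          · refine (ihc.2 hcΔ).tail ⟨⟨hce.1.1, (hcΔ.trans he.symm).subset⟩, fun b hb heb => ?_⟩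
            rw [heb, hz b hb] at he
            have := hΔinj b hb a ha he
            subst this
            exact hce.1.2 heb
          · have heI : e ∈ I := by
              by_contra heI
              exact hcΔ (ihc.1.antisymm (he ▸ hstep' c e hce.1.1 heI))
            refine ih _ ?_ e rfl heI
            rw [← hn, he]
            exact Finset.card_erase_lt_of_mem (hself a ha)
      rcases reflTransGen_avoiding_or (a := a) hpath with h | ⟨u, hu, hua⟩
      · exact absurd h (reflTransGen_avoiding_self har)
      obtain ⟨h1, h2⟩ := hall u hu
      have hΔu : Δ u = (Δ a).erase a := by
        refine h1.antisymm fun b hb => ?_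
        obtain ⟨hba, hb⟩ := Finset.mem_erase.1 hb
        exact (Finset.mem_insert.1 (hstep u a hua.1 hb)).resolve_left hba
      exact (h2 hΔu).tail ⟨⟨hua.1, hΔu ▸ Finset.erase_subset _ _⟩,
        fun b hb hab => hzI b hb (hab ▸ ha)⟩
  obtain ⟨Y, p, h, hTY, -, -, hclosed, -⟩ := (IsOutTree.singleton HZ r).exists_closed
  have hIY : I ⊆ Y := by
    intro a ha
    have hreach := hHZreach a ha
    clear ha
    induction hreach with
    | refl => exact hTY.root_mem
    | tail _ huv ih => exact hclosed _ ih _ huv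
  have hzY : ∀ a ∈ I, z a ∉ Y := fun a ha hzY => (hTY.adj _ hzY (hzr a ha)).2 a ha rfl
  obtain ⟨p', h', hT, hpp, -⟩ := (hTY.mono (R' := H) fun _ _ h => h.1).exists_spanning hHreach
  refine ⟨p', h', hT.mono fun _ _ h => h.1, ?_⟩
  have hleaf : ∀ a ∈ I, ∃ x ∈ treeLeaves Finset.univ r p', Δ x = (Δ a).erase a := by
    intro a ha
    -- A child of a vertex outside `Y` is outside `Y`, hence not in `I`, so an `H`-arc to it stays
    -- in the same layer. The vertex of greatest rank in the layer outside `Y` is therefore a leaf.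
    obtain ⟨x, hx, hmax⟩ := (Finset.univ.filter fun v => v ∉ Y ∧ Δ v = (Δ a).erase a).exists_max_image
      h' ⟨z a, by simp [hzY a ha, hz a ha]⟩
    obtain ⟨-, hxY, hxΔ⟩ := Finset.mem_filter.1 hx
    refine ⟨x, mem_treeLeaves.2 ⟨Finset.mem_univ _, fun w _ hwr hpw => ?_⟩, hxΔ⟩
    have hwY : w ∉ Y := by
      intro hwY
      rw [hpp w hwY] at hpw
      exact hxY (hpw ▸ hTY.parent_mem w hwY hwr)
    have hxw : H x w := hpw ▸ hT.adj w (Finset.mem_univ _) hwr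
    have hwΔ : Δ w = (Δ a).erase a :=
      hxΔ ▸ (hstep' x w hxw.1 fun hwI => hwY (hIY hwI)).antisymm hxw.2
    have h1 := hmax w (Finset.mem_filter.2 ⟨Finset.mem_univ _, hwY, hwΔ⟩)
    have h2 := hT.rank_lt w (Finset.mem_univ _) hwr
    rw [hpw] at h2
    exact absurd h1 (not_le.2 h2)
  choose! f hf hfΔ using hleaf
  refine Finset.card_le_card_of_injOn f hf fun a ha b hb he => hΔinj a ha b hb ?_
  rw [← hfΔ a ha, ← hfΔ b hb, he]

/-- If no arc into an out-tree `S` with root `s` comes from a vertex that its head dominates, some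
spanning out-tree has a leaf for every leaf of `S` that dominates `s`. -/
theorem IsOutTree.exists_spanning_card_dominators_le {S : Finset V} {s : V} {p : V → V} {h : V → ℕ}
    (hT : IsOutTree A S s p h) (hr : ∀ v, ReflTransGen A r v) (hrS : r ∉ S)
    (huse : ∀ u v, v ∈ S → A u v → ¬ Dominates A r v u) {I : Finset V}
    (hI : ∀ a ∈ I, a ∈ treeLeaves S s p ∧ Dominates A r a s) (hs : s ∉ treeLeaves S s p) :
    ∃ p h, IsOutTree A Finset.univ r p h ∧ I.card ≤ (treeLeaves Finset.univ r p).card := by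
  classical
  set Δ : V → Finset V := fun v => I.filter fun a => Dominates A r a v with hΔdef
  have hΔ : ∀ a v, a ∈ Δ v ↔ a ∈ I ∧ Dominates A r a v := by simp [hΔdef]
  have hIS : ∀ a ∈ I, a ∈ S := fun a ha => (mem_treeLeaves.1 (hI a ha).1).1
  have hIs : ∀ a ∈ I, a ≠ s := fun a ha h => hs (h ▸ (hI a ha).1)
  have hpI : ∀ v ∈ S, v ≠ s → p v ∉ I := fun v hv hvs hpv =>
    (mem_treeLeaves.1 (hI _ hpv).1).2 v hv hvs rfl
  have htotal : ∀ a ∈ I, ∀ b ∈ I, Dominates A r a b ∨ Dominates A r b a := fun a ha b hb =>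
    (hI a ha).2.total (hr s) (hI b hb).2
  -- Climbing towards `s` within `S` must leave the layer, because `a` dominates `s`; stop at the
  -- last vertex before it does.
  have hclimb : ∀ a ∈ I, ∀ v ∈ S, v ∉ I → Δ v = (Δ a).erase a →
      ∃ z ∈ S, z ≠ s ∧ z ∉ I ∧ Δ z = (Δ a).erase a ∧ Δ (p z) ≠ Δ z := by
    intro a ha v
    induction hn : h v using Nat.strong_induction_on generalizing v with
    | _ n ih =>
      intro hv hvI hvΔ
      have hvs : v ≠ s := by
        rintro rfl
        have : a ∈ Δ v := (hΔ a v).2 ⟨ha, (hI a ha).2⟩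
        rw [hvΔ] at this
        simp at this
      by_cases hp : Δ (p v) = Δ v
      · exact ih _ (hn ▸ hT.rank_lt v hv hvs) (p v) rfl (hT.parent_mem v hv hvs)
          (hpI v hv hvs) (hp.trans hvΔ)
      · exact ⟨v, hv, hvs, hvI, hvΔ, hp⟩
  have hz : ∀ a ∈ I, ∃ z, Δ z = (Δ a).erase a ∧ z ∉ I ∧ z ≠ r ∧ ¬ Dominates A r z a := by
    intro a ha
    have hpa : A (p a) a := hT.adj a (hIS a ha) (hIs a ha)
    have hnd := huse _ _ (hIS a ha) hpa
    obtain ⟨z, hzS, hzs, hzI, hzΔ, hpz⟩ := hclimb a ha (p a) (hT.parent_mem a (hIS a ha) (hIs a ha))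
      (hpI a (hIS a ha) (hIs a ha)) <| by
        ext b
        rw [Finset.mem_erase, hΔ, hΔ]
        constructor
        · rintro ⟨hb, hd⟩
          refine ⟨fun h => hnd (h ▸ hd), hb, ?_⟩
          exact (htotal b hb a ha).resolve_right fun h => hnd (h.trans hd)
        · rintro ⟨hba, hb, hd⟩
          exact ⟨hb, hd.of_adj hpa fun h => hba h.symm⟩
    refine ⟨z, hzΔ, hzI, fun h => hrS (h ▸ hzS), fun hza => ?_⟩
    have hpzA : A (p z) z := hT.adj z hzS hzs
    -- Some `c ∈ I` dominates `p z` but not `z`. It is `a` or is dominated by `a`, so `a` dominates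
    -- `p z`; then so would `z`, against `huse`.
    refine huse _ _ hzS hpzA (hza.trans ?_)
    have hsub : Δ z ⊆ Δ (p z) := fun b hb => by
      obtain ⟨hbI, hbd⟩ := (hΔ b z).1 hb
      exact (hΔ b _).2 ⟨hbI, hbd.of_adj hpzA fun h => hzI (h ▸ hbI)⟩
    obtain ⟨c, hc, hcz⟩ := Finset.exists_of_ssubset (hsub.ssubset_of_ne fun h => hpz h.symm)
    obtain ⟨hcI, hcd⟩ := (hΔ c _).1 hc
    by_cases hca : c = a
    · exact hca ▸ hcd
    · refine ((htotal a ha c hcI).resolve_right fun h => hcz ?_).trans hcd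
      rw [hzΔ]
      exact Finset.mem_erase.2 ⟨hca, (hΔ c a).2 ⟨hcI, h⟩⟩
  choose! z hz1 hz2 hz3 hz4 using hz
  exact Digraph.exists_spanning_card_dominators_le hr (fun h => hrS (hIS r h))
    (fun a ha => (hI a ha).2) Δ hΔ z hz1 hz2 hz3 hz4

/-- If every arc lies on a path from a vertex that reaches everything, then out-trees have at most
three times as many leaves as spanning out-trees. -/
theorem IsOutTree.card_treeLeaves_le {S : Finset V} {s : V} {p : V → V} {h : V → ℕ}
    (hT : IsOutTree A S s p h) (hr : ∀ v, ReflTransGen A r v)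
    (huse : ∀ u v, A u v → ∃ r', (∀ x, ReflTransGen A r' x) ∧ ¬ Dominates A r' v u) {k : ℕ}
    (hk : ∀ r p h, IsOutTree A Finset.univ r p h → (treeLeaves Finset.univ r p).card ≤ k) :
    (treeLeaves S s p).card ≤ 3 * k := by
  classical
  by_cases hs : ∀ v, ReflTransGen A s v
  · obtain ⟨p', h', hT', -, hle⟩ := hT.exists_spanning hs
    have := hk _ _ _ hT'
    omega
  have hS : ∀ v ∈ S, ¬ ∀ x, ReflTransGen A v x := fun v hv hx =>
    hs fun x => (hT.reflTransGen hv).trans (hx x)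
  have hrS : r ∉ S := fun h => hS r h hr
  have huse' : ∀ u v, v ∈ S → A u v → ¬ Dominates A r v u := by
    intro u v hv huv
    obtain ⟨r', hr', hd⟩ := huse u v huv
    -- A walk from `r` to `r'` runs through vertices that reach everything, and no vertex of `S`
    -- does, so it avoids `v`.
    have key : ∀ y, ReflTransGen A r y → (∀ x, ReflTransGen A y x) →
        ReflTransGen (fun x y => A x y ∧ y ≠ v) r y := by
      intro y hy
      induction hy with
      | refl => exact fun _ => .refl
      | @tail b c _ hbc ih =>
        exact fun hc => (ih fun x => .head hbc (hc x)).tail ⟨hbc, fun h => hS v hv (h ▸ hc)⟩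
    exact not_dominates_iff.2 ⟨fun h => hrS (h ▸ hv),
      (key r' (hr r') hr').trans (not_dominates_iff.1 hd).2⟩
  by_cases hsl : s ∈ treeLeaves S s p
  · have hSs : S ⊆ {s} := by
      intro v
      induction hn : h v using Nat.strong_induction_on generalizing v with
      | _ n ih =>
        intro hv
        rw [Finset.mem_singleton]
        by_contra hvs
        have := ih _ (hn ▸ hT.rank_lt v hv hvs) rfl (hT.parent_mem v hv hvs)
        exact (mem_treeLeaves.1 hsl).2 v hv hvs (Finset.mem_singleton.1 this)
    have h1 := Finset.card_le_card ((Finset.sdiff_subset (t := (S.erase s).image p)).trans hSs)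
    rw [Finset.card_singleton] at h1
    obtain ⟨p', h', hT', -⟩ := (IsOutTree.singleton A r).exists_spanning hr
    have h2 := hT'.treeLeaves_nonempty.card_pos
    have h3 := hk _ _ _ hT'
    change (treeLeaves S s p).card ≤ 1 at h1
    omega
  set L := treeLeaves S s p with hL
  set I := L.filter fun a => Dominates A r a s with hI
  have hmemI : ∀ a, a ∈ I ↔ a ∈ L ∧ Dominates A r a s := by simp [hI]
  obtain ⟨p₁, h₁, hT₁, hle₁⟩ := hT.exists_spanning_card_dominators_le hr hrS huse'
    (I := I) (fun a ha => (hmemI a).1 ha) hsl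
  have hk₁ := hk _ _ _ hT₁
  obtain ⟨Y, pY, hY, hTY, hsY, hYc⟩ := exists_isOutTree_card_inter_le hr L
    (fun h => hrS (mem_treeLeaves.1 h).1) s I hmemI
  obtain ⟨p₂, h₂, hT₂, hsub⟩ := hTY.join hT hsY
  obtain ⟨p₃, h₃, hT₃, -, hle₃⟩ := hT₂.exists_spanning hr
  have hk₃ := hk _ _ _ hT₃
  have h4 := Finset.card_le_card hsub
  have h5 : (L \ Y).card + (L ∩ Y).card = L.card := Finset.card_sdiff_add_card_inter L Y
  rw [Finset.inter_comm] at h5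
  change (L \ Y).card ≤ _ at h4
  omega

end Digraph

/-! ### From useless arcs to dominators, and the main theorem. -/

namespace Digraph

open Relation

/-- The root of an out-branching reaches every vertex, and reaches the tail of each arc of the
out-branching without using its head. -/
theorem IsOutBranching.exists_not_dominates {V : Type*} [Finite V] {D T : Digraph V}
    (hT : D.IsOutBranching T) {u v : V} (huv : T.Adj u v) :
    ∃ r, (∀ x, ReflTransGen D.Adj r x) ∧ ¬ Dominates D.Adj r v u := by
  obtain ⟨r, hr0, hr1⟩ := hT.exists_root
  have hroot : ∀ x, ¬ T.Adj x r := by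
    intro x hx
    rw [inDegree, Set.ncard_eq_zero (Set.toFinite _)] at hr0
    exact (Set.ext_iff.1 hr0 x).1 hx
  have huniq : ∀ x y w, T.Adj x w → T.Adj y w → x = y := by
    intro x y w hx hy
    have hw : w ≠ r := fun h => hroot x (h ▸ hx)
    obtain ⟨a, ha⟩ := Set.ncard_eq_one.1 (hr1 w hw)
    have hxa : x ∈ ({a} : Set V) := ha ▸ hx
    have hya : y ∈ ({a} : Set V) := ha ▸ hy
    exact (Set.mem_singleton_iff.1 hxa).trans (Set.mem_singleton_iff.1 hya).symm
  have hreach : ∀ x, ReflTransGen T.Adj r x := by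
    intro x
    have := (SimpleGraph.reachable_iff_reflTransGen r x).1 (hT.isTree.1.preconnected r x)
    induction this with
    | refl => exact .refl
    | @tail b c _ hbc ih =>
      obtain ⟨-, hbc | hcb⟩ := (SimpleGraph.fromRel_adj _ _ _).1 hbc
      · exact ih.tail hbc
      -- An edge traversed against its arc leads back to the unique parent, which the directed walk
      -- has already visited.
      · rcases ReflTransGen.cases_tail ih with he | ⟨w, hw, hwb⟩
        · exact absurd (he ▸ hcb) (hroot c)
        · exact huniq _ _ _ hwb hcb ▸ hw
  refine ⟨r, fun x => reflTransGen_of_imp (fun _ _ h => hT.le h) (hreach x),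
    not_dominates_iff.2 ⟨fun h => hroot u (h ▸ huv), ?_⟩⟩
  have hav : ReflTransGen (fun x y => T.Adj x y ∧ y ≠ v) r u := by
    rcases reflTransGen_avoiding_or (a := v) (hreach u) with h | ⟨w, hw, hwv⟩
    · exact h
    · exact huniq _ _ _ hwv huv ▸ hw
  exact reflTransGen_of_imp (fun _ _ h => ⟨hT.le h.1, h.2⟩) hav

end Digraph

theorem mainTheorem3 {V : Type*} [Fintype V] (D : Digraph V)
    (hloopless : ∀ v : V, ¬ D.Adj v v)
    (hdeg : (∀ v : V, 3 ≤ D.inDegree v) ∨ (D.IsOriented ∧ ∀ v : V, 2 ≤ D.inDegree v)) :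
    (D.IsStronglyConnected →
      1 / 4 * Real.sqrt (Fintype.card V : ℝ) ≤ (D.maxLeaves : ℝ)) ∧
    ((∀ u v : V, ¬ D.IsUseless u v) →
      1 / 12 * Real.sqrt (Fintype.card V : ℝ) ≤ (D.maxLeaves : ℝ)) := by
  classical
  rcases isEmpty_or_nonempty V with hV | ⟨⟨v₀⟩⟩
  · simp
  refine ⟨fun hsc => ?_, fun huseless => ?_⟩
  · obtain ⟨p, h, hT, -⟩ := (Digraph.IsOutTree.singleton D.Adj v₀).exists_spanning (hsc v₀)
    have hn := hT.card_le hloopless hdeg (K := D.maxLeaves) fun S r p h hS => by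
      obtain ⟨p', h', hT', -, hle⟩ := hS.exists_spanning (hsc r)
      exact hle.trans hT'.card_treeLeaves_le_maxLeaves
    have hn' : (Fintype.card V : ℝ) ≤ (4 * D.maxLeaves : ℝ) ^ 2 := by
      have : (Fintype.card V : ℝ) ≤ 16 * (D.maxLeaves : ℝ) ^ 2 := by exact_mod_cast hn
      linarith
    have := Real.sqrt_le_iff.2 ⟨by positivity, hn'⟩
    linarith
  · have huse : ∀ u v, D.Adj u v →
        ∃ r, (∀ x, Relation.ReflTransGen D.Adj r x) ∧ ¬ Digraph.Dominates D.Adj r v u := by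
      intro u v huv
      obtain ⟨T, hT, hTuv⟩ := not_not.1 fun hcon => huseless u v ⟨huv, hcon⟩
      exact hT.exists_not_dominates hTuv
    obtain ⟨u, hu⟩ : ∃ u, D.Adj u v₀ := by
      have hpos : 0 < D.inDegree v₀ := hdeg.elim (fun h => by linarith [h v₀])
        (fun h => by linarith [h.2 v₀])
      exact Set.nonempty_of_ncard_ne_zero hpos.ne'
    obtain ⟨r, hr, -⟩ := huse u v₀ hu
    obtain ⟨p, h, hT, -⟩ := (Digraph.IsOutTree.singleton D.Adj r).exists_spanning hr
    have hn := hT.card_le hloopless hdeg (K := 3 * D.maxLeaves) fun S s p h hS =>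
      hS.card_treeLeaves_le hr huse fun r p h hT => hT.card_treeLeaves_le_maxLeaves
    have hn' : (Fintype.card V : ℝ) ≤ (12 * D.maxLeaves : ℝ) ^ 2 := by
      have : (Fintype.card V : ℝ) ≤ 16 * (3 * (D.maxLeaves : ℝ)) ^ 2 := by exact_mod_cast hn
      linarith
    have := Real.sqrt_le_iff.2 ⟨by positivity, hn'⟩
    linarith
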